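/- **Setting.** An *oriented graph* is a directed graph without loops in which no two vertices are joined by arcs in both directions; it is *$d$-regular* (*bipartite*) if its underlying undirected graph is $d$-regular (bipartite). For a bipartition $(L,R)$ of the vertex set, the *size of the directed cut* $(L,R)$ is the number of arcs with tail in $L$ and head in $R$; $\mathrm{maxdicut}(G)$ is the maximum of this size over all bipartitions. In the LOCAL model the vertices of $G$ are processors with unlimited computational power. On a $d$-regular graph with $n$ vertices, each vertex has a unique identifier from $\{1,\dots,M\}$ (with $M\ge n$) and an arbitrary numbering of its $d$ incident arcs by ports, and it initially knows $n$, $d$, its own identifier, and which of its ports are outgoing. In each synchronous round every vertex sends a message of unrestricted size through each of its ports (in both directions along arcs), receives the messages of its neighbours, and updates its state deterministically. At some point each vertex irrevocably outputs its side ($L$ or $R$) of the cut. For $\rho>0$, a deterministic algorithm is a *$\rho$-approximation of MaxDiCut in $T$ rounds* on the $d$-regular bipartite $n$-vertex oriented graphs if on every such graph $G$, for every port numbering and every assignment of distinct identifiers from $\{1,\dots,M\}$, all vertices have produced their output after $T$ rounds and the resulting directed cut has size at least $\rho\cdot\mathrm{maxdicut}(G)$. The iterated logarithm is defined by $\log^*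 x=0$ if $x\le 1$ and $\log^* x=1+\log^*(\log_2 x)$ otherwise. **Theorem.** Let $d>0$ be a fixed integer. * If $d$ is even, then any deterministic constant factor approximation of MaxDiCut on the class of $d$-regular bipartite $n$-vertex oriented graphs requires $\Omega(\log^* n)$ rounds in the LOCAL model. That is, for every $\rho>0$ there are $c>0$ and $n_0$, depending only on $d$ and $\rho$, such that for every even $n\ge n_0$, every $M\ge n$ and every $T\ge 0$: if some deterministic algorithm is a $\rho$-approximation of MaxDiCut in $T$ rounds on the $d$-regular bipartite $n$-vertex oriented graphs with identifiers from $\{1,\dots,M\}$, then $T\ge c\log^* n$. * If $d$ is odd, then for every $\varepsilon>0$, any deterministic $\left(\frac2d+\varepsilon\right)$-approximation of MaxDiCut on the class of $d$-regular bipartite $n$-vertex oriented graphs requires $\Omega(\log^* n)$ rounds in the LOCAL model. That is, for every $\varepsilon>0$ there are $c>0$ and $n_0$, depending only on $d$ and $\varepsilon$, such that for every even $n\ge n_0$, every $M\ge n$ and every $T\ge 0$: if some deterministic algorithm is a $\left(\frac2d+\varepsilon\right)$-approximation of MaxDiCut in $T$ rounds on the $d$-regular bipartite $n$-vertex oriented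 graphs with identifiers from $\{1,\dots,M\}$, then $T\ge c\log^* n$. (Only even $n$ are considered since for $d>0$ a $d$-regular bipartite graph has an even number of vertices.) -/

import Mathlib

/-! ### Oriented graphs and directed cuts -/

/-- A digraph is an oriented graph if no two vertices are joined by arcs in both directions;
in particular there are no loops. -/
def Digraph.IsOriented {V : Type} (G : Digraph V) : Prop :=
  ∀ u v : V, G.Adj u v → ¬ G.Adj v u

/-- `G` is a `d`-regular bipartite oriented graph: it is an oriented graph whose underlying
undirected graph is `d`-regular and bipartite (the out-degrees are arbitrary). -/
structure Digraph.IsRegularBipartiteOriented {V : Type} (d : ℕ) (G : Digraph V) : Prop where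
  oriented : G.IsOriented
  regular : ∀ v : V, (G.toSimpleGraphInclusive.neighborSet v).ncard = d
  bipartite : G.toSimpleGraphInclusive.IsBipartite

/-- A cut is given by a function `s : V → Bool`, where `false` (the output `0`) is the left side
and `true` (the output `1`) is the right side. The size of the directed cut is the number of arcs
with their tail on the left side and their head on the right side. -/
noncomputable def Digraph.dicutSize {V : Type} (G : Digraph V) (s : V → Bool) : ℕ :=
  {e : V × V | G.Adj e.1 e.2 ∧ s e.1 = false ∧ s e.2 = true}.ncard

/-- The maximum size of a directed cut of a (finite) digraph. -/
noncomputable def Digraph.maxDicut {V : Type} (G : Digraph V) : ℕ :=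
  ⨆ s : V → Bool, G.dicutSize s

/-! ### The LOCAL model -/

/-- A network: a digraph together with, at each vertex, a numbering of the incident arcs by the
ports `0, …, d - 1` (its existence makes the underlying graph `d`-regular), and pairwise distinct
identifiers. Communication is possible in both directions along an arc. -/
structure LocalNetwork (d : ℕ) (V : Type) where
  graph : Digraph V
  port : ∀ v : V, Fin d ≃ graph.toSimpleGraphInclusive.neighborSet v
  id : V → ℕ
  id_injective : Function.Injective id

namespace LocalNetwork

variable {d : ℕ} {V : Type}

/-- The neighbour of `v` at its port `i`. -/
def nbr (N : LocalNetwork d V) (v : V) (i : Fin d) : V := (N.port v i : V)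

/-- The port by which the neighbour of `v` at port `i` is connected to `v`. -/
def backPort (N : LocalNetwork d V) (v : V) (i : Fin d) : Fin d :=
  (N.port (N.nbr v i)).symm
    ⟨v, SimpleGraph.Adj.symm (show N.graph.toSimpleGraphInclusive.Adj v _ from (N.port v i).2)⟩

open Classical in
/-- The port `i` of `v` is outgoing if the arc at this port has its tail at `v`. -/
noncomputable def isOut (N : LocalNetwork d V) (v : V) (i : Fin d) : Bool :=
  decide (N.graph.Adj v (N.nbr v i))

end LocalNetwork

/-- A deterministic algorithm in the LOCAL model, for networks in which all degrees are `d`.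
Every node starts in a state that depends on the number `n` of nodes, on its own identifier, and on
which of its ports are outgoing. In each round every node sends one message through each of its
ports, computed from its state, and computes its new state from its old state and from the messages
received through its ports. There is no restriction on the states, on the messages, or on the
functions. A node outputs a side of the cut at some point (`none`: no output yet), and outputs are
irrevocable. -/
structure LocalAlgorithm (d : ℕ) where
  State : Type
  Msg : Type
  init : (n : ℕ) → (id : ℕ) → (isOut : Fin d → Bool) → State
  send : State → Fin d → Msg
  receive : State → (Fin d → Msg) → State
  output : State → Option Bool
  output_receive : ∀ (x : State) (m : Fin d → Msg) (b : Bool),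
    output x = some b → output (receive x m) = some b

namespace LocalAlgorithm

variable {d : ℕ} {V : Type} [Fintype V]

/-- The state of each node after `t` synchronous rounds. -/
noncomputable def state (A : LocalAlgorithm d) (N : LocalNetwork d V) : ℕ → V → A.State
  | 0, v => A.init (Fintype.card V) (N.id v) (N.isOut v)
  | t + 1, v => A.receive (state A N t v)
      (fun i => A.send (state A N t (N.nbr v i)) (N.backPort v i))

/-- After `T` rounds every node has output a side of the cut, and these outputs form the cut `s`. -/
def OutputsWithin (A : LocalAlgorithm d) (N : LocalNetwork d V) (T : ℕ) (s : V → Bool) : Prop :=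
  ∀ v : V, A.output (A.state N T v) = some (s v)

/-- `A` is a `ρ`-approximation algorithm for MaxDiCut, running in at most `T` rounds, on the
`d`-regular bipartite oriented graphs with `n` vertices and identifiers from `{1, …, M}`: on every
such graph, for all port numberings and all assignments of distinct identifiers, all nodes have
produced their output after `T` rounds, and the size of the resulting directed cut is at least
`ρ` times the maximum. -/
def ApproximatesMaxDicut (A : LocalAlgorithm d) (ρ : ℝ) (n M T : ℕ) : Prop :=
  ∀ (V : Type) [Fintype V], Fintype.card V = n →
    ∀ N : LocalNetwork d V, N.graph.IsRegularBipartiteOriented d →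
      (∀ v : V, 1 ≤ N.id v ∧ N.id v ≤ M) →
        ∃ s : V → Bool, A.OutputsWithin N T s ∧
          ρ * (N.graph.maxDicut : ℝ) ≤ (N.graph.dicutSize s : ℝ)

end LocalAlgorithm

/-! ### The iterated logarithm -/

/-- The iterated logarithm `log* x`: the number of times the base `2` logarithm has to be applied,
starting from `x`, until the value is at most `1`. -/
noncomputable def logStar (x : ℝ) : ℕ :=
  sInf {k : ℕ | (Real.logb 2)^[k] x ≤ 1}

/-!
Write `d = 2 * h + e` with `e ≤ 1`, and `n = 2 * m`. The bad instance is a *strip*: two cyclic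
sequences ("sides") of `m` vertices each, in which every vertex has arcs to the vertices `1, 3, …,
2 * h - 1` steps ahead on its side, and, if `e = 1`, arcs from each vertex of the first side to the
vertex at the same position of the second side. For odd `m` the two sides are exchanged after going
around once, which makes the graph bipartite for every `m`. The graph is `d`-regular, so some
bipartition class gives a directed cut of size at least `m * d / 2`. On the other hand, a cut that
is constant on each side contains at most the `e * m` arcs across the strip, which is a fraction
`2 * e / d` of `m * d / 2`. It remains to choose identifiers that force a fast algorithm to produce
a cut that is almost everywhere locally constant on each side
(`exists_bound_of_approximatesMaxDicut`).

If the identifiers are given by a list `L` of the numbers less than `m`, one for each position,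
then after `T` rounds the pair of outputs at a position is a function `F` of the window of
`k = 4 * h * T + 1` consecutive entries of `L` around it (`output_stripVertex`). Suppose that some
set `S` of numbers contained no long increasing list along which `F` is constant on all windows.
Then the value of `F` together with the length of the longest constant run would properly colour the
shift graph on the increasing `k`-lists in `S`. A proper colouring of the `(k + 1)`-lists by `C`
gives a proper colouring of the `k`-lists by sets of colours, since a list `l` can be coloured by
the set of the colours of all lists `l ++ [b]`. Hence the size of `S` would be at most a tower of twos
of height about `k` (`card_le_of_proper_shift_colouring`). So constant runs, each much longer than
`k`, can be split off until a tower of height `O(T)` many numbers remain, and concatenating the runs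
yields the list `L` (`exists_list_windowChanges_le`). The value of `F` changes only around the
seams and on the remainder, so unless `n` is bounded by a tower of height `O(T)`, the resulting
directed cut is too small; this means that `logStar n` is `O(T)`.
-/

/-! ### Colourings of shift graphs -/

theorem card_le_of_proper_shift_colouring (S : Finset ℕ) (k : ℕ) :
    ∀ (C : Type) [Fintype C] (c : List ℕ → C),
      (∀ l : List ℕ, l.length = k + 2 → l.Pairwise (· < ·) → (∀ x ∈ l, x ∈ S) →
        c l.dropLast ≠ c l.tail) →
      S.card ≤ (fun x => 2 ^ x)^[k] (Fintype.card C) := by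
  induction k with
  | zero =>
    intro C _ c hc
    have hne : ∀ a ∈ S, ∀ b ∈ S, a < b → c [a] ≠ c [b] := by
      intro a ha b hb hab
      simpa using hc [a, b] rfl (by simpa using hab) (by simp [ha, hb])
    have hinj : Set.InjOn (fun a => c [a]) (S : Set ℕ) := by
      intro a ha b hb hab
      rcases lt_trichotomy a b with h | h | h
      · exact absurd hab (hne a ha b hb h)
      · exact h
      · exact absurd hab.symm (hne b hb a ha h)
    simpa using Finset.card_le_card_of_injOn (t := Finset.univ) (fun a => c [a])
      (fun _ _ => Finset.mem_coe.2 (Finset.mem_univ _)) hinj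
  | succ k ih =>
    intro C _ c hc
    classical
    have key := ih (Set C)
      (fun l => {y | ∃ b ∈ S, (l ++ [b]).Pairwise (· < ·) ∧ c (l ++ [b]) = y}) ?_
    · rw [Fintype.card_set] at key
      exact key
    intro l hl hlt hS heq
    have hne : l ≠ [] := by
      rintro rfl
      simp at hl
    have hmem : c l ∈ {y | ∃ b ∈ S, (l.dropLast ++ [b]).Pairwise (· < ·) ∧
        c (l.dropLast ++ [b]) = y} :=
      ⟨l.getLast hne, hS _ (List.getLast_mem hne),
        by rwa [List.dropLast_append_getLast], by rw [List.dropLast_append_getLast]⟩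
    rw [heq] at hmem
    obtain ⟨b, hb, hlt', hcb⟩ := hmem
    obtain ⟨a, t, rfl⟩ := List.exists_cons_of_ne_nil hne
    simp only [List.tail_cons] at hlt' hcb
    obtain ⟨a', t, rfl⟩ : ∃ a' t', t = a' :: t' := by
      cases t with
      | nil => simp at hl
      | cons a' t' => exact ⟨a', t', rfl⟩
    have h1 : a < a' := (List.pairwise_cons.1 hlt).1 a' (by simp)
    have h2 : a' < b := (List.pairwise_cons.1 hlt').1 b (by simp)
    have hsort : (a :: a' :: t ++ [b]).Pairwise (· < ·) := by
      rw [List.cons_append, List.pairwise_cons]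
      refine ⟨fun x hx => ?_, hlt'⟩
      rcases List.mem_append.1 hx with hx | hx
      · exact (List.pairwise_cons.1 hlt).1 x hx
      · rw [List.mem_singleton.1 hx]
        exact h1.trans h2
    refine hc (a :: a' :: t ++ [b]) (by simp at hl ⊢; omega) hsort ?_ ?_
    · intro x hx
      rcases List.mem_append.1 hx with hx | hx
      · exact hS x hx
      · rwa [List.mem_singleton.1 hx]
    · rw [List.dropLast_concat]
      exact hcb.symm

/-! ### Orderings with few window changes -/

section WindowChanges

variable {D : Type} [DecidableEq D]

/-- The number of positions `i` at which the windows of length `k` of the list `l` that start at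
`i` and at `i + 1` (both contained in `l`) have different values under `F`. -/
def windowChanges (F : List ℕ → D) (k : ℕ) (l : List ℕ) : ℕ :=
  ∑ i ∈ Finset.range l.length,
    if i + 1 + k ≤ l.length ∧ F ((l.drop i).take k) ≠ F ((l.drop (i + 1)).take k) then 1 else 0

theorem windowChanges_cons (F : List ℕ → D) (k a : ℕ) (l : List ℕ) :
    windowChanges F k (a :: l) = windowChanges F k l +
      if k ≤ l.length ∧ F ((a :: l).take k) ≠ F (l.take k) then 1 else 0 := by
  unfold windowChanges
  rw [List.length_cons, Finset.sum_range_succ']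
  congr 1
  · refine Finset.sum_congr rfl fun i _ => ?_
    simp only [List.drop_succ_cons]
    congr 2
    simp only [eq_iff_iff]
    omega
  · simp only [List.drop_zero, List.drop_succ_cons]
    congr 2
    simp only [eq_iff_iff]
    omega

theorem windowChanges_eq_zero_of_length_le (F : List ℕ → D) {k : ℕ} {l : List ℕ}
    (h : l.length ≤ k) : windowChanges F k l = 0 :=
  Finset.sum_eq_zero fun i _ => if_neg fun hi => by omega

theorem windowChanges_le_length (F : List ℕ → D) (k : ℕ) (l : List ℕ) :
    windowChanges F k l ≤ l.length := by
  unfold windowChanges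
  calc _ ≤ ∑ i ∈ Finset.range l.length, 1 :=
        Finset.sum_le_sum fun i _ => by split_ifs <;> simp
    _ = l.length := by simp

theorem windowChanges_append_le (F : List ℕ → D) (k : ℕ) (l₁ l₂ : List ℕ) :
    windowChanges F k (l₁ ++ l₂) ≤ windowChanges F k l₁ + k + windowChanges F k l₂ := by
  suffices h : windowChanges F k (l₁ ++ l₂) ≤
      windowChanges F k l₁ + min k l₁.length + windowChanges F k l₂ by omega
  induction l₁ with
  | nil => simp
  | cons a l ih =>
    rw [List.cons_append, windowChanges_cons, windowChanges_cons, List.length_cons]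
    by_cases hk : k ≤ l.length
    · rw [← List.cons_append, List.take_append_of_le_length (l₂ := l₂) hk,
        List.take_append_of_le_length (by simp; omega : k ≤ (a :: l).length)]
      simp only [hk, true_and, List.length_append, (by omega : k ≤ l.length + l₂.length)]
      split_ifs <;> omega
    · split_ifs <;> omega

/-- A sufficiently large set of integers contains an increasing list along which the windows of
length `k + 1` all have the same value. Otherwise, the value of a window together with the maximal
length of a constant run that starts with it is a proper colouring of the shift graph. -/
theorem exists_windowChanges_eq_zero [Fintype D] (F : List ℕ → D) (k r : ℕ) (S : Finset ℕ)
    (hS : (fun x => 2 ^ x)^[k] (Fintype.card D * (r + 1)) < S.card) :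
    ∃ l : List ℕ, l.length = k + 1 + (r + 1) ∧ l.Pairwise (· < ·) ∧ (∀ x ∈ l, x ∈ S) ∧
      windowChanges F (k + 1) l = 0 := by
  classical
  by_contra hno
  let P : List ℕ → ℕ → Prop := fun l j =>
    ∃ l' : List ℕ, l'.length = k + 1 + j ∧ l'.Pairwise (· < ·) ∧ (∀ x ∈ l', x ∈ S) ∧
      windowChanges F (k + 1) l' = 0 ∧ l'.take (k + 1) = l
  refine absurd (card_le_of_proper_shift_colouring S k (D × Fin (r + 1))
    (fun l => (F l, ⟨Nat.findGreatest (P l) r, Nat.lt_succ_of_le (Nat.findGreatest_le r)⟩))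
    ?_) (by simpa using hS)
  intro l hl hlt hlS heq
  obtain ⟨a, t, rfl⟩ := List.exists_cons_of_length_eq_add_one hl
  simp only [List.tail_cons, Prod.mk.injEq, Fin.mk.injEq] at heq
  obtain ⟨hF, hrun⟩ := heq
  have htl : t.length = k + 1 := by simpa using hl
  have hdrop : (a :: t).dropLast = (a :: t).take (k + 1) := by
    rw [List.dropLast_eq_take, hl]
    rfl
  have h0 : P t 0 := ⟨t, by omega, (List.pairwise_cons.1 hlt).2, fun x hx => hlS x (by simp [hx]),
    windowChanges_eq_zero_of_length_le F htl.le, by rw [List.take_of_length_le htl.le]⟩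
  obtain ⟨l', hl', hlt', hS', hw', ht'⟩ := Nat.findGreatest_spec (Nat.zero_le r) h0
  set j := Nat.findGreatest (P t) r with hj
  have hpre : (a :: l').take (k + 1) = (a :: t).take (k + 1) := by
    rw [← ht', List.take_succ_cons, List.take_succ_cons, List.take_take]
    congr 2
    omega
  have hP : P (a :: t).dropLast (j + 1) := by
    refine ⟨a :: l', by simp [hl']; omega, ?_, ?_, ?_, ?_⟩
    · rw [List.pairwise_cons]
      refine ⟨fun x hx => ?_, hlt'⟩
      obtain ⟨b, t', rfl⟩ := List.exists_cons_of_length_eq_add_one htl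
      obtain ⟨b', l'', rfl⟩ := List.exists_cons_of_ne_nil
        (by rintro rfl; simp at ht' : l' ≠ [])
      have hb : b' = b := by
        rw [List.take_succ_cons] at ht'
        exact (List.cons.inj ht').1
      have hab : a < b := (List.pairwise_cons.1 hlt).1 b (by simp)
      rcases List.mem_cons.1 hx with hx | hx
      · omega
      · have := (List.pairwise_cons.1 hlt').1 x hx
        omega
    · intro x hx
      rcases List.mem_cons.1 hx with rfl | hx
      · exact hlS x (by simp)
      · exact hS' x hx
    · rw [windowChanges_cons, hw', if_neg]
      rintro ⟨-, hne⟩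
      rw [hpre, ← hdrop, hF, ht'] at hne
      exact hne rfl
    · rw [hpre, hdrop]
  rcases (Nat.findGreatest_le r : j ≤ r).lt_or_eq with hjr | hjr
  · exact absurd ((Nat.le_findGreatest hjr hP).trans hrun.le) (Nat.not_succ_le_self _)
  · obtain ⟨l', h1, h2, h3, h4, -⟩ := hP
    exact hno ⟨l', by omega, h2, h3, h4⟩

/-- Every finite set of integers can be listed so that few window values change: constant runs are
split off as long as enough elements remain. -/
theorem exists_list_windowChanges_le [Fintype D] (F : List ℕ → D) (k r : ℕ) (S : Finset ℕ) :
    ∃ l : List ℕ, l.Nodup ∧ l.toFinset = S ∧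
      (k + 1 + (r + 1)) * windowChanges F (k + 1) l ≤
        (k + 1 + (r + 1)) * (fun x => 2 ^ x)^[k] (Fintype.card D * (r + 1)) +
          (k + 1) * S.card := by
  induction hn : S.card using Nat.strong_induction_on generalizing S with
  | _ n ih =>
    subst hn
    by_cases hS : (fun x => 2 ^ x)^[k] (Fintype.card D * (r + 1)) < S.card
    · obtain ⟨b, hlen, hlt, hbS, hb⟩ := exists_windowChanges_eq_zero F k r S hS
      have hbn : b.Nodup := hlt.imp fun h => ne_of_lt h
      have hsub : b.toFinset ⊆ S := fun x hx => hbS x (List.mem_toFinset.1 hx)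
      have hcard : (S \ b.toFinset).card + (k + 1 + (r + 1)) = S.card := by
        rw [← hlen, ← List.toFinset_card_of_nodup hbn]
        exact Finset.card_sdiff_add_card_eq_card hsub
      obtain ⟨l, hl, hlS, hw⟩ := ih _ (by omega) (S \ b.toFinset) rfl
      refine ⟨b ++ l, ?_, ?_, ?_⟩
      · refine hbn.append hl fun x hx hx' => ?_
        have : x ∈ S \ b.toFinset := hlS ▸ List.mem_toFinset.2 hx'
        exact (Finset.mem_sdiff.1 this).2 (List.mem_toFinset.2 hx)
      · rw [List.toFinset_append, hlS, Finset.union_sdiff_of_subset hsub]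
      · have h1 := windowChanges_append_le F (k + 1) b l
        rw [hb, zero_add] at h1
        have h2 := Nat.mul_le_mul_left (k + 1 + (r + 1)) h1
        rw [← hcard]
        nlinarith
    · refine ⟨S.toList, S.nodup_toList, S.toList_toFinset, ?_⟩
      have h := windowChanges_le_length F (k + 1) S.toList
      rw [Finset.length_toList] at h
      exact (Nat.mul_le_mul_left _ (h.trans (not_lt.1 hS))).trans (Nat.le_add_right _ _)

end WindowChanges

/-! ### The iterated logarithm and towers of twos -/

/-- The tower of `k` twos, `2 ^ 2 ^ ⋯ ^ 2`. -/
def twoTower (k : ℕ) : ℕ := (fun x => 2 ^ x)^[k] 1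

theorem twoTower_succ (k : ℕ) : twoTower (k + 1) = 2 ^ twoTower k :=
  Function.iterate_succ_apply' _ _ _

theorem lt_twoTower (k : ℕ) : k < twoTower k := by
  induction k with
  | zero => simp [twoTower]
  | succ k ih =>
    rw [twoTower_succ]
    exact lt_of_le_of_lt ih Nat.lt_two_pow_self

theorem twoTower_mono : Monotone twoTower :=
  monotone_nat_of_le_succ fun k => by
    rw [twoTower_succ]
    exact Nat.lt_two_pow_self.le

theorem iterate_two_pow_mono (k : ℕ) : Monotone (fun x : ℕ => 2 ^ x)^[k] :=
  Monotone.iterate (fun _ _ h => Nat.pow_le_pow_right (by norm_num) h) k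

theorem iterate_two_pow_le_twoTower (k q : ℕ) : (fun x => 2 ^ x)^[k] q ≤ twoTower (k + q) := by
  unfold twoTower
  rw [Function.iterate_add_apply]
  exact iterate_two_pow_mono k (lt_twoTower q).le

theorem mul_twoTower_le (c k : ℕ) : c * twoTower k ≤ twoTower (k + c) := by
  induction c with
  | zero => simp
  | succ c ih =>
    have h1 : twoTower k ≤ twoTower (k + c) := twoTower_mono (Nat.le_add_right _ _)
    have h2 : twoTower (k + c) + twoTower (k + c) ≤ twoTower (k + c + 1) := by
      rw [twoTower_succ]
      have := Nat.mul_le_pow (by norm_num : 2 ≠ 1) (twoTower (k + c))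
      omega
    rw [← add_assoc, Nat.succ_mul]
    omega

theorem exists_iterate_logb_le_one (k : ℕ) :
    ∀ x : ℝ, x ≤ twoTower k → ∃ j ≤ k, (Real.logb 2)^[j] x ≤ 1 := by
  induction k with
  | zero => exact fun x hx => ⟨0, le_rfl, by simpa [twoTower] using hx⟩
  | succ k ih =>
    intro x hx
    rcases le_or_gt x 1 with h1 | h1
    · exact ⟨0, Nat.zero_le _, h1⟩
    · obtain ⟨j, hj, hle⟩ := ih (Real.logb 2 x) (by
        rw [Real.logb_le_iff_le_rpow (by norm_num) (by linarith), Real.rpow_natCast]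
        rw [twoTower_succ] at hx
        exact_mod_cast hx)
      exact ⟨j + 1, by omega, hle⟩

theorem logStar_le_of_le_twoTower {x : ℝ} {k : ℕ} (h : x ≤ twoTower k) : logStar x ≤ k := by
  obtain ⟨j, hj, hle⟩ := exists_iterate_logb_le_one k x h
  exact (Nat.sInf_le hle).trans hj

theorem one_lt_iterate_logb (k : ℕ) :
    ∀ x : ℝ, (twoTower k : ℝ) < x → ∀ j ≤ k, 1 < (Real.logb 2)^[j] x := by
  induction k with
  | zero =>
    intro x hx j hj
    obtain rfl : j = 0 := by omega
    simpa [twoTower] using hx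
  | succ k ih =>
    intro x hx j hj
    have hpos : (1 : ℝ) < x := by
      have : (1 : ℝ) ≤ twoTower (k + 1) := by
        exact_mod_cast (Nat.succ_le_of_lt (lt_twoTower (k + 1))).trans' (by omega)
      linarith
    cases j with
    | zero => exact hpos
    | succ j =>
      refine ih (Real.logb 2 x) ?_ j (by omega)
      rw [Real.lt_logb_iff_rpow_lt (by norm_num) (by linarith), Real.rpow_natCast]
      rw [twoTower_succ] at hx
      exact_mod_cast hx

theorem lt_logStar_of_twoTower_lt {n k : ℕ} (h : twoTower k < n) : k < logStar (n : ℝ) := by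
  -- The set in the definition of `logStar` has to be nonempty, since otherwise its infimum is `0`.
  obtain ⟨j, -, hj⟩ := exists_iterate_logb_le_one n n (by exact_mod_cast (lt_twoTower n).le)
  have hmem : (Real.logb 2)^[logStar (n : ℝ)] (n : ℝ) ≤ 1 :=
    Nat.sInf_mem (s := {k : ℕ | (Real.logb 2)^[k] (n : ℝ) ≤ 1}) ⟨j, hj⟩
  by_contra hle
  exact absurd hmem
    (not_le.2 (one_lt_iterate_logb k n (by exact_mod_cast h) _ (not_lt.1 hle)))

/-! ### Port graphs -/

/-- A bipartite oriented graph presented by ports: `nbr v p` is the neighbour of `v` at the port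
`p`, to which `v` is connected by the port `back v p`; the arc leaves `v` if `out v p` holds, and
`colour` is a bipartition. -/
structure PortGraph (V P : Type) where
  nbr : V → P → V
  back : V → P → P
  out : V → P → Bool
  colour : V → Bool
  nbr_injective : ∀ v, Function.Injective (nbr v)
  nbr_back : ∀ v p, nbr (nbr v p) (back v p) = v
  out_back : ∀ v p, out (nbr v p) (back v p) = !out v p
  colour_nbr : ∀ v p, colour (nbr v p) = !colour v

namespace PortGraph

variable {V P : Type} (G : PortGraph V P)

/-- The oriented graph presented by a port graph. -/
def toDigraph : Digraph V := ⟨fun u v => ∃ p, G.out u p = true ∧ G.nbr u p = v⟩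

theorem adj_nbr_iff (v : V) (p : P) : G.toDigraph.Adj v (G.nbr v p) ↔ G.out v p = true := by
  constructor
  · rintro ⟨q, hq, hqp⟩
    rwa [← G.nbr_injective v hqp]
  · exact fun h => ⟨p, h, rfl⟩

theorem isOriented : G.toDigraph.IsOriented := by
  rintro u _ ⟨p, hp, rfl⟩ h
  have := (G.adj_nbr_iff (G.nbr u p) (G.back u p)).1 (by rwa [G.nbr_back])
  rw [G.out_back, hp] at this
  exact absurd this (by decide)

theorem mem_neighborSet_iff (u v : V) :
    v ∈ G.toDigraph.toSimpleGraphInclusive.neighborSet u ↔ ∃ p, G.nbr u p = v := by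
  constructor
  · rintro ⟨-, ⟨p, -, hp⟩ | ⟨p, -, hp⟩⟩
    · exact ⟨p, hp⟩
    · exact ⟨G.back v p, by rw [← hp, G.nbr_back]⟩
  · rintro ⟨p, rfl⟩
    refine ⟨fun h => ?_, ?_⟩
    · have := G.colour_nbr u p
      rw [← h] at this
      exact absurd this (by cases G.colour u <;> decide)
    · cases h : G.out u p with
      | true => exact Or.inl ⟨p, h, rfl⟩
      | false => exact Or.inr ⟨G.back u p, by rw [G.out_back, h]; rfl, G.nbr_back u p⟩

/-- The ports of `v`, numbered by `φ`, correspond to the neighbours of `v`. -/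
noncomputable def portEquiv {d : ℕ} (φ : Fin d ≃ P) (v : V) :
    Fin d ≃ G.toDigraph.toSimpleGraphInclusive.neighborSet v :=
  Equiv.ofBijective (fun i => ⟨G.nbr v (φ i), (G.mem_neighborSet_iff _ _).2 ⟨_, rfl⟩⟩)
    ⟨fun _ _ h => φ.injective (G.nbr_injective v (Subtype.ext_iff.1 h)), fun ⟨u, hu⟩ => by
      obtain ⟨p, rfl⟩ := (G.mem_neighborSet_iff _ _).1 hu
      exact ⟨φ.symm p, by simp⟩⟩

theorem isRegularBipartiteOriented {d : ℕ} (φ : Fin d ≃ P) :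
    G.toDigraph.IsRegularBipartiteOriented d where
  oriented := G.isOriented
  regular v := by
    rw [← Nat.card_coe_set_eq, ← Nat.card_congr (G.portEquiv φ v), Nat.card_fin]
  bipartite := by
    refine ⟨fun v => if G.colour v then 0 else 1, fun {u v} huv => ?_⟩
    obtain ⟨p, rfl⟩ := (G.mem_neighborSet_iff _ _).1 huv
    rw [G.colour_nbr]
    cases G.colour u <;> simp

/-- The network on a port graph with ports numbered by `φ` and with the given identifiers. -/
noncomputable def network {d : ℕ} (φ : Fin d ≃ P) (id : V → ℕ) (hid : Function.Injective id) :
    LocalNetwork d V where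
  graph := G.toDigraph
  port := G.portEquiv φ
  id := id
  id_injective := hid

section Network

variable {d : ℕ} (φ : Fin d ≃ P) (id : V → ℕ) (hid : Function.Injective id)

theorem network_nbr (v : V) (i : Fin d) : (G.network φ id hid).nbr v i = G.nbr v (φ i) := rfl

theorem network_backPort (v : V) (i : Fin d) :
    (G.network φ id hid).backPort v i = φ.symm (G.back v (φ i)) := by
  unfold LocalNetwork.backPort
  rw [Equiv.symm_apply_eq]
  refine Subtype.ext ?_
  change v = G.nbr (G.nbr v (φ i)) (φ (φ.symm (G.back v (φ i))))
  rw [Equiv.apply_symm_apply, G.nbr_back]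

theorem network_isOut (v : V) (i : Fin d) :
    (G.network φ id hid).isOut v i = G.out v (φ i) := by
  classical
  refine Bool.eq_iff_iff.2 (Iff.trans ?_ (G.adj_nbr_iff v (φ i)))
  exact decide_eq_true_iff

end Network

section Cuts

variable [Fintype V]

theorem dicutSize_le_maxDicut (s : V → Bool) : G.toDigraph.dicutSize s ≤ G.toDigraph.maxDicut :=
  le_ciSup (Set.finite_range G.toDigraph.dicutSize).bddAbove s

variable [Fintype P]

theorem dicutSize_toDigraph (s : V → Bool) :
    G.toDigraph.dicutSize s =
      (Finset.univ.filter fun x : V × P =>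
        G.out x.1 x.2 = true ∧ s x.1 = false ∧ s (G.nbr x.1 x.2) = true).card := by
  classical
  rw [← Finset.card_image_of_injective (f := fun x : V × P => (x.1, G.nbr x.1 x.2)),
    ← Set.ncard_coe_finset]
  · unfold Digraph.dicutSize
    congr 1
    ext ⟨u, v⟩
    simp only [Set.mem_ofPred_eq, Finset.coe_image, Finset.coe_filter, Finset.mem_univ, true_and,
      Set.mem_image, Prod.mk.injEq, Prod.exists]
    constructor
    · rintro ⟨⟨p, hp, rfl⟩, hu, hv⟩
      exact ⟨u, p, ⟨hp, hu, hv⟩, rfl, rfl⟩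
    · rintro ⟨u, p, ⟨hp, hu, hv⟩, rfl, rfl⟩
      exact ⟨⟨p, hp, rfl⟩, hu, hv⟩
  · rintro ⟨u, p⟩ ⟨v, q⟩ h
    obtain ⟨rfl, h⟩ := Prod.mk.inj h
    exact Prod.ext rfl (G.nbr_injective u h)

theorem two_mul_card_out :
    2 * (Finset.univ.filter fun x : V × P => G.out x.1 x.2 = true).card =
      Fintype.card V * Fintype.card P := by
  classical
  have h1 : (Finset.univ.filter fun x : V × P => G.out x.1 x.2 = true).card =
      (Finset.univ.filter fun x : V × P => ¬ G.out x.1 x.2 = true).card := by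
    have hback : ∀ v p, G.back (G.nbr v p) (G.back v p) = p := fun v p =>
      G.nbr_injective v (by
        have := G.nbr_back (G.nbr v p) (G.back v p)
        rwa [G.nbr_back v p] at this)
    refine Finset.card_bij' (fun x _ => (G.nbr x.1 x.2, G.back x.1 x.2))
      (fun x _ => (G.nbr x.1 x.2, G.back x.1 x.2)) ?_ ?_ ?_ ?_
    · intro x hx
      simpa [G.out_back] using hx
    · intro x hx
      simpa [G.out_back] using hx
    · exact fun x _ => by simp [G.nbr_back, hback]
    · exact fun x _ => by simp [G.nbr_back, hback]
  have h2 := Finset.card_filter_add_card_filter_not (s := (Finset.univ : Finset (V × P)))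
    (fun x => G.out x.1 x.2 = true)
  rw [Finset.card_univ, Fintype.card_prod] at h2
  omega

/-- One of the two directed cuts given by a bipartition contains half of the arcs. -/
theorem card_mul_card_le_four_mul_maxDicut :
    Fintype.card V * Fintype.card P ≤ 4 * G.toDigraph.maxDicut := by
  classical
  have h1 := G.dicutSize_le_maxDicut G.colour
  have h2 := G.dicutSize_le_maxDicut fun v => !G.colour v
  rw [dicutSize_toDigraph] at h1 h2
  have h3 : (Finset.univ.filter fun x : V × P => G.out x.1 x.2 = true) ⊆
      (Finset.univ.filter fun x : V × P => G.out x.1 x.2 = true ∧ G.colour x.1 = false ∧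
        G.colour (G.nbr x.1 x.2) = true) ∪
      (Finset.univ.filter fun x : V × P => G.out x.1 x.2 = true ∧ (!G.colour x.1) = false ∧
        (!G.colour (G.nbr x.1 x.2)) = true) := by
    intro x hx
    simp only [Finset.mem_union, Finset.mem_filter, Finset.mem_univ, true_and,
      G.colour_nbr] at hx ⊢
    cases G.colour x.1 <;> simp [hx]
  have h4 := (Finset.card_le_card h3).trans (Finset.card_union_le _ _)
  have h5 := G.two_mul_card_out
  omega

end Cuts

end PortGraph

/-! ### The twisted strip -/

/-- The ports of a vertex of the strip: `Sum.inl (j, b)` leads `2 * j + 1` steps forward or backward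
along the strip, and `Sum.inr _` (of which there will be at most one) leads to the other side. -/
abbrev StripPort (h e : ℕ) : Type := (Fin h × Bool) ⊕ Fin e

namespace StripPort

variable {h e : ℕ}

/-- The displacement along the strip. -/
def offset : StripPort h e → ℤ
  | .inl (j, true) => 2 * (j : ℤ) + 1
  | .inl (j, false) => -(2 * (j : ℤ) + 1)
  | .inr _ => 0

/-- Whether the port leads to the other side of the strip. -/
def cross : StripPort h e → Bool
  | .inl _ => false
  | .inr _ => true

/-- The port by which one returns. -/
def back : StripPort h e → StripPort h e
  | .inl (j, b) => .inl (j, !b)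
  | .inr x => .inr x

/-- Arcs point forward along the strip, and from the side `false` to the side `true` across it. -/
def out (s : Bool) : StripPort h e → Bool
  | .inl (_, b) => b
  | .inr _ => !s

theorem offset_back (p : StripPort h e) : p.back.offset = -p.offset := by
  rcases p with ⟨j, _ | _⟩ | x <;> simp [back, offset]

theorem cross_back (p : StripPort h e) : p.back.cross = p.cross := by
  rcases p with ⟨j, _ | _⟩ | x <;> rfl

theorem out_back (s : Bool) (p : StripPort h e) :
    p.back.out (s ^^ p.cross) = !p.out s := by
  rcases p with ⟨j, _ | _⟩ | x <;> simp [back, out, cross]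

theorem abs_offset_le (p : StripPort h e) : |p.offset| ≤ 2 * h := by
  rcases p with ⟨⟨j, hj⟩, _ | _⟩ | x <;> simp only [offset, abs_le] <;> omega

theorem odd_offset (p : StripPort h e) : decide (Odd p.offset) = !p.cross := by
  rcases p with ⟨j, _ | _⟩ | x
  · simp only [offset, cross, odd_neg]
    simp
  · simp [offset, cross]
  · simp [offset, cross]

theorem offset_injective (he : e ≤ 1) : Function.Injective (offset (h := h) (e := e)) := by
  rintro (⟨⟨j, hj⟩, _ | _⟩ | ⟨x, hx⟩) (⟨⟨j', hj'⟩, _ | _⟩ | ⟨x', hx'⟩) heq <;>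
    simp only [offset] at heq <;> simp <;> omega

end StripPort

theorem decide_odd_add (a b : ℤ) : decide (Odd (a + b)) = (decide (Odd a) ^^ decide (Odd b)) := by
  by_cases ha : Odd a <;> by_cases hb : Odd b <;> simp [Int.odd_add, ha, hb, ← Int.not_odd_iff_even]

section Strip

variable {m : ℕ} [NeZero m]

/-- The vertex at position `i` on the side `s` of the infinite strip, after wrapping the strip
around to length `m`; the two sides are exchanged by going around once if `m` is odd, so that the parity of
the position plus the side remains well defined. -/
def stripVertex (m : ℕ) [NeZero m] (i : ℤ) (s : Bool) : Bool × Fin m :=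
  (s ^^ decide (Odd (i / m * m)),
    ⟨(i % m).toNat, by
      have := Int.emod_lt_of_pos i (by exact_mod_cast NeZero.pos m : (0 : ℤ) < m)
      have := NeZero.pos m
      omega⟩)

theorem stripVertex_pos (i : ℤ) (s : Bool) : (((stripVertex m i s).2 : ℕ) : ℤ) = i % m :=
  Int.toNat_of_nonneg (Int.emod_nonneg _ (by exact_mod_cast NeZero.ne m))

theorem stripVertex_of_lt {i : ℕ} (hi : i < m) (s : Bool) : stripVertex m i s = (s, ⟨i, hi⟩) := by
  have h1 : (i : ℤ) / m = 0 := Int.ediv_eq_zero_of_lt (by omega) (by omega)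
  have h2 : (i : ℤ) % m = i := Int.emod_eq_of_lt (by omega) (by omega)
  unfold stripVertex
  ext <;> simp [h1, h2]

theorem stripVertex_self (v : Bool × Fin m) : stripVertex m (v.2 : ℕ) v.1 = v :=
  stripVertex_of_lt v.2.2 v.1

theorem stripVertex_add (i o : ℤ) (s c : Bool) :
    stripVertex m (((stripVertex m i s).2 : ℕ) + o) ((stripVertex m i s).1 ^^ c) =
      stripVertex m (i + o) (s ^^ c) := by
  have hm : (m : ℤ) ≠ 0 := by exact_mod_cast NeZero.ne m
  have hio : ((stripVertex m i s).2 : ℤ) + o = (i + o) + (-(i / m)) * m := by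
    rw [stripVertex_pos]
    have := Int.emod_add_mul_ediv i m
    linarith
  rw [hio]
  refine Prod.ext ?_ (Fin.ext ?_)
  · change ((s ^^ decide (Odd (i / m * m))) ^^ c ^^ decide (Odd (_ / (m : ℤ) * m))) =
      (s ^^ c ^^ decide (Odd ((i + o) / m * m)))
    rw [Int.add_mul_ediv_right _ _ hm, add_mul, decide_odd_add, neg_mul,
      show decide (Odd (-(i / (m : ℤ) * m))) = decide (Odd (i / (m : ℤ) * m)) by simp only [odd_neg]]
    generalize decide (Odd (i / (m : ℤ) * m)) = a
    generalize decide (Odd ((i + o) / (m : ℤ) * m)) = b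
    cases s <;> cases c <;> cases a <;> cases b <;> rfl
  · change (_ % (m : ℤ)).toNat = ((i + o) % m).toNat
    rw [Int.add_mul_emod_self_right]

/-- The colour of a vertex of the strip: the parity of its position plus its side. -/
def stripColour (v : Bool × Fin m) : Bool := v.1 ^^ decide (Odd ((v.2 : ℕ) : ℤ))

theorem stripColour_stripVertex (i : ℤ) (s : Bool) :
    stripColour (stripVertex m i s) = (s ^^ decide (Odd i)) := by
  unfold stripColour
  rw [stripVertex_pos]
  conv_rhs => rw [← Int.ediv_mul_add_emod i m, decide_odd_add]
  exact Bool.xor_assoc _ _ _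

variable {h e : ℕ}

/-- The strip of length `m` with `2 * h` ports along the strip and `e` ports across it at every
vertex. -/
def stripGraph (m : ℕ) [NeZero m] (he : e ≤ 1) (hm : 4 * h < m) :
    PortGraph (Bool × Fin m) (StripPort h e) where
  nbr v p := stripVertex m ((v.2 : ℕ) + p.offset) (v.1 ^^ p.cross)
  back _ p := p.back
  out v p := p.out (v.1)
  colour := stripColour
  nbr_injective v p q hpq := by
    refine StripPort.offset_injective he ?_
    have h1 : (((v.2 : ℕ) : ℤ) + p.offset) % m = ((v.2 : ℕ) + q.offset) % m := by
      rw [← stripVertex_pos _ (v.1 ^^ p.cross), ← stripVertex_pos _ (v.1 ^^ q.cross)]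
      exact congrArg (fun u => (((u.2 : Fin m) : ℕ) : ℤ)) hpq
    have h3 : (m : ℤ) ∣ p.offset - q.offset := by
      have := Int.ModEq.dvd (Int.ModEq.symm h1)
      rwa [add_sub_add_left_eq_sub] at this
    have h4 := Int.eq_zero_of_abs_lt_dvd h3 (by
      have hp := abs_le.1 p.abs_offset_le
      have hq := abs_le.1 q.abs_offset_le
      rw [abs_lt]
      constructor <;> omega)
    omega
  nbr_back v p := by
    rw [stripVertex_add, StripPort.offset_back, StripPort.cross_back]
    rw [add_neg_cancel_right, Bool.xor_assoc, Bool.xor_self, Bool.xor_false]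
    exact stripVertex_self v
  out_back v p := by
    rcases p with ⟨j, b⟩ | x
    · rfl
    · -- Ports across the strip do not change the position, so no twist is involved.
      have : stripVertex m ((v.2 : ℕ) + 0) (v.1 ^^ true) = (v.1 ^^ true, v.2) := by
        rw [add_zero]
        exact stripVertex_of_lt v.2.2 _
      change StripPort.out (stripVertex m ((v.2 : ℕ) + 0) (v.1 ^^ true)).1
        (StripPort.back (Sum.inr x)) = _
      rw [this]
      exact StripPort.out_back v.1 (Sum.inr x)
  colour_nbr v p := by
    rw [stripColour_stripVertex, decide_odd_add, StripPort.odd_offset]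
    unfold stripColour
    generalize decide (Odd ((v.2 : ℕ) : ℤ)) = a
    cases v.1 <;> cases a <;> cases p.cross <;> rfl

end Strip

/-! ### Running an algorithm on the strip -/

section Simulation

variable {d h e : ℕ}

/-- The state after `t` rounds of the vertex on the side `s` at position `0` of the infinite
strip, if the vertex on the side `s'` at position `j` starts in the state `lab j s'`. -/
def stripState (A : LocalAlgorithm d) (φ : Fin d ≃ StripPort h e) :
    ℕ → (ℤ → Bool → A.State) → Bool → A.State
  | 0, lab, s => lab 0 s
  | t + 1, lab, s => A.receive (stripState A φ t lab s) fun i =>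
      A.send (stripState A φ t (fun j => lab ((φ i).offset + j)) (s ^^ (φ i).cross))
        (φ.symm (φ i).back)

/-- The states after `t` rounds depend only on the initial states at distance at most `2 * h * t`
along the strip. -/
theorem stripState_congr (A : LocalAlgorithm d) (φ : Fin d ≃ StripPort h e) (t : ℕ) :
    ∀ (lab lab' : ℤ → Bool → A.State) (s : Bool),
      (∀ (j : ℤ) s', |j| ≤ 2 * h * t → lab j s' = lab' j s') →
        stripState A φ t lab s = stripState A φ t lab' s := by
  induction t with
  | zero => exact fun lab lab' s hlab => hlab 0 s (by simp)
  | succ t ih =>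
    intro lab lab' s hlab
    have hstep : (2 * h * (t + 1 : ℕ) : ℤ) = 2 * h * t + 2 * h := by push_cast; ring
    rw [hstep] at hlab
    have h1 : stripState A φ t lab s = stripState A φ t lab' s :=
      ih _ _ s fun j s' hj => hlab j s' (by omega)
    have h2 : ∀ i, stripState A φ t (fun j => lab ((φ i).offset + j)) (s ^^ (φ i).cross) =
        stripState A φ t (fun j => lab' ((φ i).offset + j)) (s ^^ (φ i).cross) := fun i =>
      ih _ _ _ fun j s' hj => hlab _ s' (by
        have := abs_add_le (φ i).offset j
        have := (φ i).abs_offset_le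
        omega)
    simp only [stripState, h1, h2]

variable {m : ℕ}

/-- The identifiers given by a list `L` that orders the numbers less than `m`: the two vertices at
position `i` get the identifiers `2 * L[i] + 1` and `2 * L[i] + 2`. -/
def stripId (m : ℕ) (L : List ℕ) (v : Bool × Fin m) : ℕ := 2 * L.getD v.2 0 + v.1.toNat + 1

theorem stripId_injective {L : List ℕ} (hlen : L.length = m) (hL : L.Nodup) :
    Function.Injective (stripId m L) := by
  rintro ⟨s, i, hi⟩ ⟨s', i', hi'⟩ heq
  simp only [stripId] at heq
  rw [List.getD_eq_getElem _ _ (by omega), List.getD_eq_getElem _ _ (by omega)] at heq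
  have hs := Bool.toNat_le s
  have hs' := Bool.toNat_le s'
  have h1 : L[i] = L[i'] := by omega
  have h2 : s.toNat = s'.toNat := by omega
  have h3 : i = i' := (hL.getElem_inj_iff).1 h1
  subst h3
  have : s = s' := by cases s <;> cases s' <;> simp_all
  rw [this]

variable [NeZero m]

theorem state_stripVertex (A : LocalAlgorithm d) (φ : Fin d ≃ StripPort h e) (he : e ≤ 1)
    (hm : 4 * h < m) (id : Bool × Fin m → ℕ) (hid : Function.Injective id) (t : ℕ) :
    ∀ (i : ℤ) (s : Bool),
      A.state ((stripGraph m he hm).network φ id hid) t (stripVertex m i s) =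
        stripState A φ t (fun j s' =>
          A.state ((stripGraph m he hm).network φ id hid) 0 (stripVertex m (i + j) s')) s := by
  induction t with
  | zero =>
    intro i s
    simp only [stripState, add_zero]
  | succ t ih =>
    intro i s
    rw [LocalAlgorithm.state, stripState, ih]
    congr 1
    funext p
    rw [PortGraph.network_nbr, PortGraph.network_backPort]
    have : (stripGraph m he hm).nbr (stripVertex m i s) (φ p) =
        stripVertex m (i + (φ p).offset) (s ^^ (φ p).cross) := stripVertex_add _ _ _ _
    rw [this, ih]
    simp only [add_assoc]
    rfl

/-- The initial states around a vertex, read off from the list `l` of the values `L[i]` at the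
positions at distance at most `r` from the vertex. -/
def windowLabel (A : LocalAlgorithm d) (φ : Fin d ≃ StripPort h e) (n r : ℕ) (l : List ℕ) (j : ℤ)
    (s : Bool) : A.State :=
  A.init n (2 * l.getD (j + r).toNat 0 + s.toNat + 1) fun i => (φ i).out s

/-- The outputs after `T` rounds of the two vertices at a position, as a function of the list of the
values `L[i]` at the positions at distance at most `2 * h * T`. -/
def windowOutput (A : LocalAlgorithm d) (φ : Fin d ≃ StripPort h e) (n T : ℕ) (l : List ℕ) :
    Option Bool × Option Bool :=
  (A.output (stripState A φ T (windowLabel A φ n (2 * h * T) l) false),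
    A.output (stripState A φ T (windowLabel A φ n (2 * h * T) l) true))

theorem output_stripVertex (A : LocalAlgorithm d) (φ : Fin d ≃ StripPort h e) (he : e ≤ 1)
    (hm : 4 * h < m) (T : ℕ) {L : List ℕ} (hlen : L.length = m)
    (hid : Function.Injective (stripId m L)) {i : ℕ} (hi : i + (2 * (2 * h * T) + 1) ≤ m)
    (s : Bool) :
    A.output (A.state ((stripGraph m he hm).network φ (stripId m L) hid) T
        (stripVertex m ((i + 2 * h * T : ℕ) : ℤ) s)) =
      bif s then (windowOutput A φ (2 * m) T ((L.drop i).take (2 * (2 * h * T) + 1))).2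
        else (windowOutput A φ (2 * m) T ((L.drop i).take (2 * (2 * h * T) + 1))).1 := by
  have key : A.state ((stripGraph m he hm).network φ (stripId m L) hid) T
      (stripVertex m ((i + 2 * h * T : ℕ) : ℤ) s) =
      stripState A φ T (windowLabel A φ (2 * m) (2 * h * T)
        ((L.drop i).take (2 * (2 * h * T) + 1))) s := by
    rw [state_stripVertex]
    refine stripState_congr A φ T _ _ s fun j s' hj => ?_
    have hj' : |j| ≤ ((2 * h * T : ℕ) : ℤ) := by exact_mod_cast hj
    generalize 2 * h * T = r at *
    obtain ⟨a, ha⟩ : ∃ a : ℕ, j + r = a :=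
      ⟨(j + r).toNat, (Int.toNat_of_nonneg (by have := abs_le.1 hj'; omega)).symm⟩
    have ha' : a < 2 * r + 1 := by have := abs_le.1 hj'; omega
    have hpos : (((i + r : ℕ) : ℤ) + j) = ((i + a : ℕ) : ℤ) := by push_cast; omega
    have hlt : i + a < m := by omega
    rw [hpos, stripVertex_of_lt hlt]
    have hget : ((L.drop i).take (2 * r + 1)).getD (j + r).toNat 0 = L.getD (i + a) 0 := by
      rw [ha, Int.toNat_natCast]
      rw [List.getD_eq_getElem _ _ (by simp; omega), List.getD_eq_getElem _ _ (by omega)]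
      simp
    unfold windowLabel
    rw [hget]
    unfold LocalAlgorithm.state
    congr 1
    · simp [mul_comm]
    · funext p
      rw [PortGraph.network_isOut]
      rfl
  cases s <;> simp only [windowOutput, key, cond_true, cond_false]

end Simulation

/-! ### Directed cuts of the strip -/

theorem card_ne_add_le {m : ℕ} (z : ℕ → Bool) (w : ℕ) : ∀ o ≤ w,
    ((Finset.range m).filter fun i => z i ≠ z (i + o)).card ≤
      o * ((Finset.range (m + w)).filter fun j => z j ≠ z (j + 1)).card := by
  intro o
  induction o with
  | zero => simp
  | succ o ih =>
    intro ho
    have hsub : ((Finset.range m).filter fun i => z i ≠ z (i + (o + 1))) ⊆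
        ((Finset.range m).filter fun i => z i ≠ z (i + o)) ∪
          ((Finset.range m).filter fun i => z (i + o) ≠ z (i + o + 1)) := by
      intro i hi
      simp only [Finset.mem_union, Finset.mem_filter] at hi ⊢
      by_cases hz : z i = z (i + o)
      · exact Or.inr ⟨hi.1, hz ▸ hi.2⟩
      · exact Or.inl ⟨hi.1, hz⟩
    have hshift : ((Finset.range m).filter fun i => z (i + o) ≠ z (i + o + 1)).card ≤
        ((Finset.range (m + w)).filter fun j => z j ≠ z (j + 1)).card := by
      refine Finset.card_le_card_of_injOn (fun i => i + o) (fun i hi => ?_)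
        fun _ _ _ _ hab => Nat.add_right_cancel hab
      simp only [Finset.coe_filter, Finset.mem_range, Set.mem_ofPred_eq] at hi ⊢
      exact ⟨by omega, hi.2⟩
    have h1 := (Finset.card_le_card hsub).trans (Finset.card_union_le _ _)
    have h2 := ih (by omega)
    rw [Nat.succ_mul]
    omega

/-- The arcs across the strip contribute at most `e * m` to a directed cut, and every arc along the
strip in the cut passes a position where the side of the cut changes. -/
theorem dicutSize_stripGraph_le {m h e : ℕ} [NeZero m] (he : e ≤ 1) (hm : 4 * h < m)
    (y : Bool × Fin m → Bool) (c : ℕ)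
    (hc : ∀ s, ((Finset.range (m + 2 * h)).filter fun j : ℕ =>
      y (stripVertex m j s) ≠ y (stripVertex m (j + 1 : ℕ) s)).card ≤ c) :
    (stripGraph (e := e) m he hm).toDigraph.dicutSize y ≤ e * m + 2 * (h * (2 * h * c)) := by
  have harc : ∀ (s : Bool) (j : Fin h),
      (∑ i : Fin m, if y (s, i) ≠ y (stripVertex m ((i : ℕ) + (2 * (j : ℕ) + 1) : ℕ) s) then 1
        else 0) ≤ 2 * h * c := by
    intro s j
    have h1 := card_ne_add_le (m := m) (fun i : ℕ => y (stripVertex m i s)) (2 * h)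
      (2 * j + 1) (by omega)
    have h2 : (2 * (j : ℕ) + 1) * _ ≤ 2 * h * c := Nat.mul_le_mul (by omega) (hc s)
    refine le_trans (le_of_eq ?_) (h1.trans h2)
    rw [Finset.card_filter, Finset.sum_range]
    refine Finset.sum_congr rfl fun i _ => ?_
    rw [stripVertex_of_lt i.2]
  have hvertex : ∀ (s : Bool) (i : Fin m),
      (∑ p, if (stripGraph (e := e) m he hm).out (s, i) p = true ∧ y (s, i) = false ∧
        y ((stripGraph (e := e) m he hm).nbr (s, i) p) = true then 1 else 0) ≤
      (∑ j : Fin h, if y (s, i) ≠ y (stripVertex m ((i : ℕ) + (2 * (j : ℕ) + 1) : ℕ) s) then 1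
        else 0) + bif s then 0 else e := by
    intro s i
    rw [Fintype.sum_sum_type, Fintype.sum_prod_type]
    refine Nat.add_le_add (Finset.sum_le_sum fun j _ => ?_) ?_
    · have hnbr : (stripGraph (e := e) m he hm).nbr (s, i) (Sum.inl (j, true)) =
          stripVertex m ((i : ℕ) + (2 * (j : ℕ) + 1) : ℕ) s := by
        simp only [stripGraph, StripPort.offset, StripPort.cross, Bool.xor_false]
        push_cast
        rfl
      have hout : (stripGraph (e := e) m he hm).out (s, i) (Sum.inl (j, false)) = false := rfl
      rw [Fintype.sum_bool, hnbr, hout,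
        if_neg (c := false = true ∧ _) (fun hf => Bool.false_ne_true hf.1), add_zero]
      split_ifs with h1 h2
      · exact le_rfl
      · rw [not_not, h1.2.1, h1.2.2] at h2
        exact absurd h2 Bool.false_ne_true
      · exact Nat.zero_le _
      · exact le_rfl
    · cases s with
      | false =>
        refine (Finset.sum_le_sum (g := fun _ => 1) fun x _ => ?_).trans (by simp)
        split_ifs <;> simp
      | true =>
        refine (Finset.sum_eq_zero fun x _ => if_neg fun hf => ?_).le
        exact Bool.false_ne_true hf.1
  rw [PortGraph.dicutSize_toDigraph, Finset.card_filter, Fintype.sum_prod_type,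
    Fintype.sum_prod_type, Fintype.sum_bool]
  have hside : ∀ s : Bool,
      (∑ i : Fin m, ∑ p, if (stripGraph (e := e) m he hm).out (s, i) p = true ∧
        y (s, i) = false ∧ y ((stripGraph (e := e) m he hm).nbr (s, i) p) = true
          then 1 else 0) ≤ h * (2 * h * c) + m * bif s then 0 else e := by
    intro s
    refine (Finset.sum_le_sum fun i _ => hvertex s i).trans ?_
    rw [Finset.sum_add_distrib, Finset.sum_comm]
    refine Nat.add_le_add ((Finset.sum_le_sum fun j _ => harc s j).trans (by simp)) (by simp)
  have h1 := hside true
  have h2 := hside false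
  simp only [cond_true, cond_false, mul_zero, add_zero] at h1 h2
  exact (Nat.add_le_add h1 h2).trans (by rw [mul_comm e m]; omega)

/-! ### Approximation algorithms on the strip -/

/-- A cut computed in `T` rounds changes rarely along the strip if the list that gives the
identifiers has few changes of the window outputs. The positions at distance at most `2 * h * T`
from the ends of the list have to be excluded. -/
theorem card_cut_changes_le {d h e m : ℕ} [NeZero m] (A : LocalAlgorithm d)
    (φ : Fin d ≃ StripPort h e) (he : e ≤ 1) (hm : 4 * h < m) (T : ℕ) {L : List ℕ}
    (hlen : L.length = m) (hid : Function.Injective (stripId m L)) (y : Bool × Fin m → Bool)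
    (hy : A.OutputsWithin ((stripGraph m he hm).network φ (stripId m L) hid) T y) (s : Bool) :
    ((Finset.range (m + 2 * h)).filter fun j : ℕ =>
      y (stripVertex m j s) ≠ y (stripVertex m (j + 1 : ℕ) s)).card ≤
      windowChanges (windowOutput A φ (2 * m) T) (2 * (2 * h * T) + 1) L +
        (2 * (2 * h * T) + 2 * h + 1) := by
  have hout := fun i hi => output_stripVertex A φ he hm T hlen hid (i := i) hi s
  have hyout : ∀ v, A.output
      (A.state ((stripGraph m he hm).network φ (stripId m L) hid) T v) = some (y v) := hy
  simp only [hyout] at hout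
  generalize 2 * h * T = r at *
  unfold windowChanges
  rw [← Finset.card_filter, hlen]
  set F := windowOutput A φ (2 * m) T
  have hsub : ((Finset.range (m + 2 * h)).filter fun j : ℕ =>
      y (stripVertex m j s) ≠ y (stripVertex m (j + 1 : ℕ) s)) ⊆
      (((Finset.range m).filter fun i => i + 1 + (2 * r + 1) ≤ m ∧
        F ((L.drop i).take (2 * r + 1)) ≠ F ((L.drop (i + 1)).take (2 * r + 1))).image (· + r)) ∪
        (Finset.range r ∪ Finset.Ico (m - r - 1) (m + 2 * h)) := by
    intro j hj
    simp only [Finset.mem_filter, Finset.mem_range] at hj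
    simp only [Finset.mem_union, Finset.mem_image, Finset.mem_filter, Finset.mem_range,
      Finset.mem_Ico]
    by_cases h1 : j < r
    · exact Or.inr (Or.inl h1)
    by_cases h2 : m - r - 1 ≤ j
    · exact Or.inr (Or.inr ⟨h2, hj.1⟩)
    refine Or.inl ⟨j - r, ⟨by omega, by omega, fun heq => hj.2 ?_⟩, by omega⟩
    have e1 := hout (j - r) (by omega)
    have e2 := hout (j - r + 1) (by omega)
    rw [heq, ← e2, (by omega : j - r + r = j), (by omega : j - r + 1 + r = j + 1)] at e1
    exact Option.some.inj e1
  refine (Finset.card_le_card hsub).trans ((Finset.card_union_le _ _).trans ?_)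
  refine Nat.add_le_add Finset.card_image_le ((Finset.card_union_le _ _).trans ?_)
  rw [Finset.card_range, Nat.card_Ico]
  omega

/-- An approximation guarantee bounds the number `m` of positions on the strip, up to an error
term that is small compared to `m`. Here `X` is the size of a maximum directed cut, `D` that of the
computed one, and `b` the number of changes of the window outputs, if the blocks of positions with
constant window outputs have the length of `q + 2` disjoint windows. -/
theorem exists_bound_of_approximatesMaxDicut {h e m : ℕ} (he : e ≤ 1) (hm : 4 * h < m)
    (A : LocalAlgorithm (2 * h + e)) (ρ : ℝ) {M : ℕ} (hM : 2 * m ≤ M) (T q : ℕ)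
    (hA : A.ApproximatesMaxDicut ρ (2 * m) M T) :
    ∃ X D b : ℕ, ρ * X ≤ D ∧ m * (2 * h + e) ≤ 2 * X ∧
      D ≤ e * m + 2 * (h * (2 * h * (b + (2 * (2 * h * T) + 2 * h + 1)))) ∧
      (q + 2) * b ≤ (q + 2) *
        (fun x => 2 ^ x)^[2 * (2 * h * T)] (9 * ((2 * (2 * h * T) + 1) * (q + 1))) + m := by
  have : NeZero m := ⟨by omega⟩
  have φ : Fin (2 * h + e) ≃ StripPort h e :=
    (Fintype.equivFinOfCardEq (by simp [mul_comm])).symm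
  have hlast : (2 * (2 * h * T) + 1) * (q + 1) - 1 + 1 = (2 * (2 * h * T) + 1) * (q + 1) :=
    Nat.sub_add_cancel (Nat.mul_pos (by omega) (by omega))
  obtain ⟨L, hL, hLm, hw⟩ := exists_list_windowChanges_le (windowOutput A φ (2 * m) T)
    (2 * (2 * h * T)) ((2 * (2 * h * T) + 1) * (q + 1) - 1) (Finset.range m)
  rw [hlast, Finset.card_range] at hw
  have hlen : L.length = m := by
    rw [← List.toFinset_card_of_nodup hL, hLm, Finset.card_range]
  have hid := stripId_injective hlen hL
  obtain ⟨y, hy, hcut⟩ := hA (Bool × Fin m) (by simp)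
    ((stripGraph m he hm).network φ (stripId m L) hid)
    ((stripGraph m he hm).isRegularBipartiteOriented φ) (by
      rintro ⟨s, i, hi⟩
      have h1 : L[i] ∈ L.toFinset := List.mem_toFinset.2 (List.getElem_mem _)
      rw [hLm, Finset.mem_range] at h1
      have h2 := Bool.toNat_le s
      change 1 ≤ 2 * L.getD i 0 + s.toNat + 1 ∧ 2 * L.getD i 0 + s.toNat + 1 ≤ M
      rw [List.getD_eq_getElem _ _ (by omega)]
      omega)
  refine ⟨_, _, windowChanges (windowOutput A φ (2 * m) T) (2 * (2 * h * T) + 1) L, hcut, ?_,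
    dicutSize_stripGraph_le he hm y _ (card_cut_changes_le A φ he hm T hlen hid y hy), ?_⟩
  · have h1 := (stripGraph (e := e) m he hm).card_mul_card_le_four_mul_maxDicut
    rw [← Fintype.card_congr φ] at h1
    simp only [Fintype.card_prod, Fintype.card_bool, Fintype.card_fin] at h1
    change _ ≤ 2 * (stripGraph (e := e) m he hm).toDigraph.maxDicut
    nlinarith
  · have hcard : Fintype.card (Option Bool × Option Bool) = 9 := rfl
    rw [hcard] at hw
    refine Nat.le_of_mul_le_mul_left (c := 2 * (2 * h * T) + 1) ?_ (by omega)
    calc _ = (2 * (2 * h * T) + 1 + (2 * (2 * h * T) + 1) * (q + 1)) *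
          windowChanges (windowOutput A φ (2 * m) T) (2 * (2 * h * T) + 1) L := by ring
      _ ≤ _ := hw
      _ = _ := by ring

/-- If an algorithm beats the value of a cut that is constant on either side of the strip by
`ε`, then the number of rounds is at least of the order of the iterated logarithm. -/
theorem logStar_le_of_approximatesMaxDicut {h e : ℕ} (he : e ≤ 1) (hd : 0 < 2 * h + e) {ε : ℝ}
    (hε : 0 < ε) :
    ∃ c : ℝ, 0 < c ∧ ∃ n₀ : ℕ, ∀ A : LocalAlgorithm (2 * h + e),
      ∀ n : ℕ, n₀ ≤ n → Even n → ∀ M : ℕ, n ≤ M → ∀ T : ℕ,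
        A.ApproximatesMaxDicut (2 * e / ((2 * h + e : ℕ) : ℝ) + ε) n M T →
          c * (logStar (n : ℝ) : ℝ) ≤ (T : ℝ) := by
  obtain ⟨q, hq⟩ := exists_nat_ge (16 * h ^ 2 / (ε * (2 * h + e : ℕ)) : ℝ)
  have hdpos : (0 : ℝ) < (2 * h + e : ℕ) := by exact_mod_cast hd
  rw [div_le_iff₀ (mul_pos hε hdpos)] at hq
  set K := 8 * h + 36 * h * (q + 1) + 13 * (q + 1) + 2 * h + 1 with hK
  have hKpos : (0 : ℝ) < K := by exact_mod_cast (by omega : 0 < K)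
  refine ⟨1 / (2 * K), by positivity, twoTower (2 * K) + 8 * h + 2, ?_⟩
  intro A n hn hev M hM T hA
  obtain ⟨m, rfl⟩ := hev.two_dvd
  obtain ⟨X, D, b, h1, h2, h3, h4⟩ :=
    exists_bound_of_approximatesMaxDicut he (by omega) A _ hM T q hA
  have hKlog : 2 * K < logStar ((2 * m : ℕ) : ℝ) := lt_logStar_of_twoTower_lt (by omega)
  set R := (fun x => 2 ^ x)^[2 * (2 * h * T)] (9 * ((2 * (2 * h * T) + 1) * (q + 1))) with hR
  set E := R + (2 * (2 * h * T) + 2 * h + 1) with hE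
  -- The number of positions is bounded by the error term.
  have hmE : m ≤ q * E := by
    have h1' : (2 * e / ((2 * h + e : ℕ) : ℝ) + ε) * X ≤ D := h1
    have h2' : (m * (2 * h + e : ℕ) : ℝ) ≤ 2 * X := by exact_mod_cast h2
    have h3' : (D : ℝ) ≤ e * m + 4 * h ^ 2 * (b + (2 * (2 * h * T) + 2 * h + 1)) := by
      have : (D : ℝ) ≤ ((e * m + 2 * (h * (2 * h * (b + (2 * (2 * h * T) + 2 * h + 1)))) : ℕ) : ℝ) :=
        by exact_mod_cast h3
      refine this.trans (le_of_eq ?_)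
      push_cast
      ring
    have h4' : ((q : ℝ) + 2) * b ≤ (q + 2) * R + m := by exact_mod_cast h4
    have hE' : (E : ℝ) = R + (2 * (2 * h * T) + 2 * h + 1) := by rw [hE]; push_cast; ring
    generalize ((2 * h + e : ℕ) : ℝ) = δ at *
    have hem : (2 * e / δ + ε) * (m * δ / 2) = e * m + ε * δ * m / 2 := by
      field_simp
    have h5 : (2 * e / δ + ε) * (m * δ / 2) ≤ (2 * e / δ + ε) * X :=
      mul_le_mul_of_nonneg_left (by linarith) (by positivity)
    have h6 : ε * δ * m / 2 ≤ 4 * h ^ 2 * (b + (2 * (2 * h * T) + 2 * h + 1)) := by linarith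
    have hεδ : 0 < ε * δ := mul_pos hε hdpos
    have hm0 : (0 : ℝ) ≤ m := Nat.cast_nonneg m
    have hE0 : (0 : ℝ) ≤ E := Nat.cast_nonneg E
    have h7 : ((q : ℝ) + 2) * (b + (2 * (2 * h * T) + 2 * h + 1)) ≤ (q + 2) * E + m := by
      rw [hE']
      linarith
    have hq0 : (0 : ℝ) < q + 2 := by positivity
    have h8 : (q + 2) * (ε * δ * m / 2) ≤ 4 * h ^ 2 * ((q + 2) * E + m) := by
      calc _ ≤ ((q : ℝ) + 2) * (4 * h ^ 2 * (b + (2 * (2 * h * T) + 2 * h + 1))) :=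
            mul_le_mul_of_nonneg_left h6 hq0.le
        _ = 4 * h ^ 2 * (((q : ℝ) + 2) * (b + (2 * (2 * h * T) + 2 * h + 1))) := by ring
        _ ≤ _ := mul_le_mul_of_nonneg_left h7 (by positivity)
    have h9 : 4 * (h : ℝ) ^ 2 ≤ (q + 2) * (ε * δ) / 4 := by linarith
    have h10 : 4 * (h : ℝ) ^ 2 * m ≤ (q + 2) * (ε * δ) / 4 * m := mul_le_mul_of_nonneg_right h9 hm0
    have h11 : (q + 2) * (ε * δ * m / 4) ≤ (q + 2) * (4 * h ^ 2 * E) := by linarith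
    have h12 : ε * δ * m / 4 ≤ 4 * h ^ 2 * E := le_of_mul_le_mul_left h11 hq0
    have h13 : 4 * (h : ℝ) ^ 2 * E ≤ q * (ε * δ) / 4 * E :=
      mul_le_mul_of_nonneg_right (by linarith) hE0
    have h14 : ε * δ * m ≤ ε * δ * (q * E) := by linarith
    exact_mod_cast le_of_mul_le_mul_left h14 hεδ
  -- The error term is a tower of height linear in `T`.
  have hlog : logStar ((2 * m : ℕ) : ℝ) ≤ K * (T + 1) := by
    refine logStar_le_of_le_twoTower ?_
    set a := 2 * (2 * h * T) + 9 * ((2 * (2 * h * T) + 1) * (q + 1)) + (2 * (2 * h * T) + 2 * h + 1)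
      with ha
    have t1 : R ≤ twoTower a :=
      (iterate_two_pow_le_twoTower _ _).trans (twoTower_mono (Nat.le_add_right _ _))
    have t2 : 2 * (2 * h * T) + 2 * h + 1 ≤ twoTower a :=
      (lt_twoTower _).le.trans (twoTower_mono (Nat.le_add_left _ _))
    have t3 : 2 * m ≤ (4 * (q + 1)) * twoTower a := by
      have : q * E ≤ q * (2 * twoTower a) := Nat.mul_le_mul_left q (by omega)
      nlinarith
    have t4 : 2 * m ≤ twoTower (K * (T + 1)) := by
      refine t3.trans ((mul_twoTower_le _ _).trans (twoTower_mono ?_))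
      rw [ha, hK]
      nlinarith [Nat.zero_le (h * T), Nat.zero_le (q * T), Nat.zero_le (h * q), Nat.zero_le T]
    exact_mod_cast t4
  have hlog' : (logStar ((2 * m : ℕ) : ℝ) : ℝ) ≤ K * (T + 1) := by exact_mod_cast hlog
  have hKlog' : (2 * K : ℝ) ≤ logStar ((2 * m : ℕ) : ℝ) := by exact_mod_cast hKlog.le
  rw [one_div, inv_mul_le_iff₀ (by positivity)]
  linarith

theorem theorem2p4 (d : ℕ) (hd : 0 < d) :
    (Even d → ∀ ρ : ℝ, 0 < ρ →
      ∃ c : ℝ, 0 < c ∧ ∃ n₀ : ℕ, ∀ A : LocalAlgorithm d,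
        ∀ n : ℕ, n₀ ≤ n → Even n → ∀ M : ℕ, n ≤ M → ∀ T : ℕ,
          A.ApproximatesMaxDicut ρ n M T → c * (logStar (n : ℝ) : ℝ) ≤ (T : ℝ)) ∧
    (Odd d → ∀ ε : ℝ, 0 < ε →
      ∃ c : ℝ, 0 < c ∧ ∃ n₀ : ℕ, ∀ A : LocalAlgorithm d,
        ∀ n : ℕ, n₀ ≤ n → Even n → ∀ M : ℕ, n ≤ M → ∀ T : ℕ,
          A.ApproximatesMaxDicut (2 / (d : ℝ) + ε) n M T →
            c * (logStar (n : ℝ) : ℝ) ≤ (T : ℝ)) := by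
  constructor
  · intro hev ρ hρ
    obtain ⟨h, rfl⟩ := hev.two_dvd
    have key := logStar_le_of_approximatesMaxDicut (h := h) (e := 0) (by omega) (by omega) hρ
    simp only [Nat.cast_zero, mul_zero, zero_div, zero_add] at key
    exact key
  · rintro ⟨h, rfl⟩ ε hε
    have key := logStar_le_of_approximatesMaxDicut (h := h) (e := 1) (by omega) (by omega) hε
    rw [Nat.cast_one, mul_one] at key
    exact key
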